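/- Let $\mathcal G$ be a locally compact Hausdorff étale groupoid with unit space $\mathcal G^{(0)}$, source and range maps $\mathrm s,\mathrm r$, and source fibres $\mathcal G_x=\mathrm s^{-1}(x)$, $x\in\mathcal G^{(0)}$. Let $L^2(\mathcal G)$ be the Hilbert $C_0(\mathcal G^{(0)})$-module obtained by completing $C_c(\mathcal G)$ with respect to the inner product $\langle \eta,\xi\rangle(x)=\sum_{\gamma\in\mathcal G_x}\overline{\eta(\gamma)}\,\xi(\gamma)$, with module structure $(\xi a)(\gamma)=\xi(\gamma)a(\mathrm s(\gamma))$; its elements are regarded as functions on $\mathcal G$. Let $\mathscr L(L^2(\mathcal G))$ be the set of adjointable operators on $L^2(\mathcal G)$, i.e. of the maps $T\colon L^2(\mathcal G)\to L^2(\mathcal G)$ for which there is a map $S\colon L^2(\mathcal G)\to L^2(\mathcal G)$ with $\langle\eta,T\xi\rangle=\langle S\eta,\xi\rangle$ for all $\xi,\eta$. For functions $f,g$ on $\mathcal G$ write $$(f*g)(\gamma)=\sum_{\alpha\in\mathcal G_{\mathrm s(\gamma)}}f(\gamma\alpha^{-1})g(\alpha),\qquad f^*(\gamma)=\overline{f(\gamma^{-1})}.$$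 An operator $T\in\mathscr L(L^2(\mathcal G))$ is called $\mathcal G$-equivariant if $T(\xi*g)=(T\xi)*g$ for all $g\in C_c(\mathcal G)$ and $\xi\in L^2(\mathcal G)$. A bounded continuous function $f\in C_b(\mathcal G)$ is called a left convolver if $f|_{\mathcal G_x},f^*|_{\mathcal G_x}\in\ell^2(\mathcal G_x)$ for every $x\in\mathcal G^{(0)}$, $\sup_x\|f|_{\mathcal G_x}\|_2<\infty$, $\sup_x\|f^*|_{\mathcal G_x}\|_2<\infty$, and $f*g,\ f^* *g\in L^2(\mathcal G)$ for every $g\in L^2(\mathcal G)$; in this case let $\Lambda(f)\colon L^2(\mathcal G)\to L^2(\mathcal G)$ be the map $g\mapsto f*g$. For $T\in\mathscr L(L^2(\mathcal G))$ and $x\in\mathcal G^{(0)}$, the slice of $T$ at $x$ is the bounded operator $\Phi_x(T)$ on $\ell^2(\mathcal G_x)$ determined by $\Phi_x(T)(\xi|_{\mathcal G_x})=(T\xi)|_{\mathcal G_x}$ for $\xi\in L^2(\mathcal G)$. Then: 1. For every left convolver $f\in C_b(\mathcal G)$, the map $\Lambda(f)$ is a $\mathcal G$-equivariant adjointable operator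 on $L^2(\mathcal G)$. 2. Conversely, for every $\mathcal G$-equivariant $T\in\mathscr L(L^2(\mathcal G))$ there is a unique left convolver $f_T\in C_b(\mathcal G)$ such that $T=\Lambda(f_T)$. Moreover, $f_T(\gamma)=\big(\Phi_{\mathrm s(\gamma)}(T)\,\delta_{\mathrm s(\gamma)}\big)(\gamma)$ for all $\gamma\in\mathcal G$, where $\delta_{\mathrm s(\gamma)}\in\ell^2(\mathcal G_{\mathrm s(\gamma)})$ is the point mass at the unit $\mathrm s(\gamma)$. -/

import Mathlib

open CategoryTheory Filter Topology
open scoped ENNReal BoundedContinuousFunction ZeroAtInfty CompactlySupported ComplexConjugate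
  ComplexOrder

set_option linter.unusedSectionVars false

namespace EtaleGroupoid

universe u v

/-- The set of arrows of a groupoid with unit space `X`: the points `γ` of the groupoid `𝒢`.
The arrow `γ` goes from its source `s(γ) = γ.src` to its range `r(γ) = γ.tgt`. -/
structure Arr (X : Type u) [Groupoid.{v} X] : Type (max u v) where
  {src tgt : X}
  hom : src ⟶ tgt

/-- The source fibre `𝒢ₓ = s⁻¹(x)`. -/
abbrev Fiber {X : Type u} [Groupoid.{v} X] (x : X) : Type (max u v) := Σ y : X, (x ⟶ y)

section Algebra

variable {X : Type u} [Groupoid.{v} X]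

namespace Arr

/-- The unit at `x`. -/
def unit (x : X) : Arr X := ⟨𝟙 x⟩

/-- The inverse arrow `γ⁻¹`. -/
def inv (γ : Arr X) : Arr X := ⟨Groupoid.inv γ.hom⟩

/-- The product `a b` of arrows with `s(a) = r(b)`: first `b`, then `a`. -/
def mul (a b : Arr X) (h : a.src = b.tgt) : Arr X := ⟨b.hom ≫ eqToHom h.symm ≫ a.hom⟩

/-- An arrow as a point of the fibre over its source. -/
def toFiber (γ : Arr X) : Fiber γ.src := ⟨γ.tgt, γ.hom⟩

end Arr

/-- A point of a source fibre as an arrow. -/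
def Fiber.arr {x : X} (α : Fiber x) : Arr X := ⟨α.2⟩

/-- For `γ` and `α ∈ 𝒢_{s(γ)}`, the arrow `γ α⁻¹`. -/
def Arr.mulInv (γ : Arr X) (α : Fiber γ.src) : Arr X := ⟨Groupoid.inv α.2 ≫ γ.hom⟩

/-- The convolution `(f * g)(γ) = ∑_{α ∈ 𝒢_{s(γ)}} f(γ α⁻¹) g(α)`. -/
noncomputable def conv (f g : Arr X → ℂ) (γ : Arr X) : ℂ :=
  ∑' α : Fiber γ.src, f (γ.mulInv α) * g α.arr

/-- The involution `f^*(γ) = conj f(γ⁻¹)`. -/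
def adj (f : Arr X → ℂ) (γ : Arr X) : ℂ := conj (f γ.inv)

theorem Fiber.arr_injective (x : X) : Function.Injective (Fiber.arr : Fiber x → Arr X) := by
  rintro ⟨y, a⟩ ⟨z, b⟩ h
  simp only [Fiber.arr, Arr.mk.injEq] at h
  obtain ⟨-, rfl, h⟩ := h
  obtain rfl := eq_of_heq h
  rfl

theorem Fiber.arr_src {x : X} (α : Fiber x) : α.arr.src = x := rfl

theorem Fiber.exists_arr (γ : Arr X) {x : X} (h : γ.src = x) : ∃ α : Fiber x, α.arr = γ := by
  subst h; exact ⟨γ.toFiber, rfl⟩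

theorem Arr.mul_mulInv (γ : Arr X) (α : Fiber γ.src) :
    (γ.mulInv α) = Arr.mul γ (Arr.inv α.arr) rfl := by
  simp [Arr.mulInv, Arr.mul, Arr.inv, Fiber.arr]

theorem Arr.ext_of {a b : Arr X} (h : a.src = b.src) (h' : a.tgt = b.tgt)
    (e : a.hom = eqToHom h ≫ b.hom ≫ eqToHom h'.symm) : a = b := by
  cases a; cases b; dsimp at h h'; subst h; subst h'; simp at e; rw [e]

end Algebra

/-- A locally compact (Hausdorff) topological groupoid: `Arr X` carries the topology of `𝒢`, and
`X` carries the topology of the unit space, as a subspace of `𝒢`. -/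
class IsLocallyCompactGroupoid (X : Type u) [Groupoid.{v} X] [TopologicalSpace (Arr X)]
    [TopologicalSpace X] : Prop where
  t2 : T2Space (Arr X)
  locallyCompact : LocallyCompactSpace (Arr X)
  isInducing_unit : IsInducing (Arr.unit : X → Arr X)
  continuous_src : Continuous (Arr.src : Arr X → X)
  continuous_tgt : Continuous (Arr.tgt : Arr X → X)
  continuous_inv : Continuous (Arr.inv : Arr X → Arr X)
  continuous_mul : Continuous
    fun p : {p : Arr X × Arr X // p.1.src = p.2.tgt} => Arr.mul p.1.1 p.1.2 p.2

/-- A locally compact étale groupoid: the range map is a local homeomorphism. -/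
class IsLocallyCompactEtaleGroupoid (X : Type u) [Groupoid.{v} X] [TopologicalSpace (Arr X)]
    [TopologicalSpace X] : Prop extends IsLocallyCompactGroupoid X where
  isLocalHomeomorph_tgt : IsLocalHomeomorph (Arr.tgt : Arr X → X)

attribute [instance] IsLocallyCompactGroupoid.t2 IsLocallyCompactGroupoid.locallyCompact

section Topology

open IsLocallyCompactGroupoid IsLocallyCompactEtaleGroupoid

variable {X : Type u} [Groupoid.{v} X] [TopologicalSpace (Arr X)] [TopologicalSpace X]
  [IsLocallyCompactEtaleGroupoid X]

theorem isLocalHomeomorph_src : IsLocalHomeomorph (Arr.src : Arr X → X) := by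
  have h : (Arr.src : Arr X → X) = Arr.tgt ∘ Arr.inv := rfl
  have h2 : ∀ γ : Arr X, γ.inv.inv = γ := fun γ => by
    cases γ; simp [Arr.inv]
  rw [h]
  exact isLocalHomeomorph_tgt.comp
    (Homeomorph.mk ⟨Arr.inv, Arr.inv, h2, h2⟩ continuous_inv continuous_inv).isLocalHomeomorph

variable (X) in
theorem t2Space_units : T2Space X :=
  T2Space.of_injective_continuous (f := (Arr.unit : X → Arr X))
    (fun _ _ h => congrArg Arr.src h) isInducing_unit.continuous

variable (X) in
theorem locallyCompactSpace_units : LocallyCompactSpace X := by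
  have := t2Space_units X
  have h : Continuous (Arr.unit : X → Arr X) := isInducing_unit.continuous
  have : IsClosedEmbedding (Arr.unit : X → Arr X) := by
    have hs : Continuous (Arr.src : Arr X → X) := continuous_src
    refine ⟨⟨isInducing_unit, fun _ _ h => congrArg Arr.src h⟩, ?_⟩
    have : Set.range (Arr.unit : X → Arr X) = {γ | Arr.unit γ.src = γ} := by
      ext γ
      constructor
      · rintro ⟨x, rfl⟩; rfl
      · intro h; exact ⟨_, h⟩
    rw [this]
    exact isClosed_eq (h.comp hs) continuous_id
  exact this.locallyCompactSpace

/-- A compact set meets the source fibres in uniformly finitely many points. -/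
theorem exists_card_bound {K : Set (Arr X)} (hK : IsCompact K) :
    ∃ N : ℕ, ∀ x : X, {α : Fiber x | α.arr ∈ K}.encard ≤ N := by
  choose e he heq using (isLocalHomeomorph_src (X := X))
  obtain ⟨t, ht⟩ := hK.elim_finite_subcover (fun γ : Arr X => (e γ).source)
    (fun γ => (e γ).open_source) (fun γ _ => Set.mem_iUnion.2 ⟨γ, he γ⟩)
  refine ⟨t.card, fun x => ?_⟩
  have hex : ∀ α : Fiber x, α.arr ∈ K → ∃ γ ∈ t, α.arr ∈ (e γ).source := fun α hα => by
    simpa using ht hα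
  classical
  let c : Fiber x → Arr X := fun α => if h : α.arr ∈ K then (hex α h).choose else α.arr
  have hc : ∀ α : Fiber x, α.arr ∈ K → c α ∈ t ∧ α.arr ∈ (e (c α)).source := fun α hα => by
    simp only [c, hα, dif_pos]
    exact (hex α hα).choose_spec
  have : Set.InjOn c {α : Fiber x | α.arr ∈ K} := by
    intro α hα β hβ h
    have h1 := (hc α hα).2
    have h2 := (hc β hβ).2
    rw [h] at h1
    apply Fiber.arr_injective
    apply (e (c β)).injOn h1 h2
    rw [← congrFun (heq (c β)) α.arr, ← congrFun (heq (c β)) β.arr]; rfl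
  calc _ ≤ (t : Set (Arr X)).encard := Set.encard_le_encard_of_injOn (fun α hα => (hc α hα).1) this
    _ = _ := by simp

theorem finite_fiber {K : Set (Arr X)} (hK : IsCompact K) (x : X) :
    {α : Fiber x | α.arr ∈ K}.Finite := by
  obtain ⟨N, hN⟩ := exists_card_bound hK
  exact Set.finite_of_encard_le_coe (hN x)

/-- Sums over the source fibres depend continuously on parameters, as long as the summands are
supported in a fixed compact set. -/
theorem continuous_fiberSum {Z : Type*} [TopologicalSpace Z] (p : Z → X) (hp : Continuous p)
    {K : Set (Arr X)} (hK : IsCompact K) (h : ∀ z : Z, Fiber (p z) → ℂ)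
    (H : {q : Z × Arr X // q.2.src = p q.1} → ℂ) (hH : Continuous H)
    (hHh : ∀ z (α : Fiber (p z)), H ⟨(z, α.arr), rfl⟩ = h z α)
    (h0 : ∀ z (α : Fiber (p z)), α.arr ∉ K → h z α = 0) :
    Continuous fun z => ∑' α : Fiber (p z), h z α := by
  classical
  have := t2Space_units X
  have hs : Continuous (Arr.src : Arr X → X) := continuous_src
  rw [continuous_iff_continuousAt]
  intro z₀
  choose e he heq using (isLocalHomeomorph_src (X := X))
  have hes : ∀ γ : Arr X, ∀ y ∈ (e γ).target, ((e γ).symm y).src = y := fun γ y hy => by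
    rw [congrFun (heq γ)]; exact (e γ).right_inv hy
  let F : Finset (Fiber (p z₀)) := (finite_fiber hK (p z₀)).toFinset
  -- disjoint open neighbourhoods
  obtain ⟨U, hU, hUd⟩ := (F.image Fiber.arr).finite_toSet.t2_separation
  let W : Fiber (p z₀) → Set (Arr X) := fun α => U α.arr ∩ (e α.arr).source
  have hWo : ∀ α, IsOpen (W α) := fun α => (hU α.arr).2.inter (e α.arr).open_source
  have hαW : ∀ α, α.arr ∈ W α := fun α => ⟨(hU α.arr).1, he _⟩
  -- the rest of `K` avoids the fibres near `z₀`
  have hK' : IsCompact (K \ ⋃ α ∈ F, W α) :=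
    hK.diff (isOpen_biUnion fun α _ => hWo α)
  have hcl : IsClosed (Arr.src '' (K \ ⋃ α ∈ F, W α) : Set X) := (hK'.image hs).isClosed
  have hx₀ : p z₀ ∉ (Arr.src '' (K \ ⋃ α ∈ F, W α) : Set X) := by
    rintro ⟨γ, ⟨hγK, hγW⟩, hγ⟩
    obtain ⟨α, rfl⟩ := Fiber.exists_arr γ hγ
    apply hγW
    have : α ∈ F := by simpa [F] using hγK
    exact Set.mem_biUnion this (hαW α)
  -- local sections
  let τ : Fiber (p z₀) → Z → Arr X := fun α z => (e α.arr).symm (p z)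
  have htgt : ∀ α : Fiber (p z₀), p z₀ ∈ (e α.arr).target := fun α => by
    have := (e α.arr).map_source (he α.arr)
    rwa [← congrFun (heq α.arr) α.arr] at this
  have hτ0 : ∀ α, τ α z₀ = α.arr := fun α => by
    have := (e α.arr).left_inv (he α.arr)
    rwa [← congrFun (heq α.arr) α.arr] at this
  have hτc : ∀ α, ContinuousAt (τ α) z₀ := fun α =>
    ContinuousAt.comp (f := p) ((e α.arr).symm.continuousAt (htgt α)) hp.continuousAt
  have ev1 : ∀ᶠ z in 𝓝 z₀, p z ∉ (Arr.src '' (K \ ⋃ α ∈ F, W α) : Set X) :=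
    hp.continuousAt.eventually (hcl.isOpen_compl.mem_nhds hx₀)
  have ev2 : ∀ᶠ z in 𝓝 z₀, ∀ α ∈ F, p z ∈ (e α.arr).target ∧ τ α z ∈ W α := by
    rw [Filter.eventually_all_finset]
    intro α _
    refine (hp.continuousAt.eventually ((e α.arr).open_target.mem_nhds (htgt α))).and ?_
    exact (hτc α).eventually ((hWo α).mem_nhds (by rw [hτ0]; exact hαW α))
  -- near `z₀` the sum is a finite sum of continuous functions
  have key : ∀ z, p z ∉ (Arr.src '' (K \ ⋃ α ∈ F, W α) : Set X) →
      (∀ α ∈ F, p z ∈ (e α.arr).target ∧ τ α z ∈ W α) →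
      ∑' α : Fiber (p z), h z α =
        ∑ α ∈ F, if hα : (τ α z).src = p z then H ⟨(z, τ α z), hα⟩ else 0 := by
    intro z hz1 hz2
    have hsec : ∀ α ∈ F, (τ α z).src = p z := fun α hα => hes _ _ (hz2 α hα).1
    let σ : ∀ α ∈ F, Fiber (p z) := fun α hα => (Fiber.exists_arr (τ α z) (hsec α hα)).choose
    have hσ : ∀ α hα, (σ α hα).arr = τ α z := fun α hα =>
      (Fiber.exists_arr (τ α z) (hsec α hα)).choose_spec
    have hinj : ∀ a ha b hb, σ a ha = σ b hb → a = b := by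
      intro a ha b hb hab
      have h1 := congrArg Fiber.arr hab
      rw [hσ a ha, hσ b hb] at h1
      by_contra hne
      have hd := hUd (show a.arr ∈ ((F.image Fiber.arr : Finset _) : Set (Arr X)) from
        Finset.mem_coe.2 (Finset.mem_image_of_mem _ ha))
        (show b.arr ∈ ((F.image Fiber.arr : Finset _) : Set (Arr X)) from
        Finset.mem_coe.2 (Finset.mem_image_of_mem _ hb))
        (fun h => hne (Fiber.arr_injective _ h))
      exact Set.disjoint_left.1 hd (hz2 a ha).2.1 (h1 ▸ (hz2 b hb).2.1)
    have hsupp : ∀ β : Fiber (p z), β ∉ F.attach.image (fun a => σ a.1 a.2) → h z β = 0 := by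
      intro β hβ
      by_contra hne
      have hβK : β.arr ∈ K := by
        by_contra hn; exact hne (h0 z β hn)
      have : β.arr ∈ ⋃ α ∈ F, W α := by
        by_contra hn
        exact hz1 ⟨β.arr, ⟨hβK, hn⟩, rfl⟩
      obtain ⟨α, hα, hW⟩ := Set.mem_iUnion₂.1 this
      apply hβ
      refine Finset.mem_image.2 ⟨⟨α, hα⟩, Finset.mem_attach _ _, ?_⟩
      apply Fiber.arr_injective
      rw [hσ α hα]
      apply (e α.arr).injOn (hz2 α hα).2.2 hW.2
      rw [← congrFun (heq α.arr), ← congrFun (heq α.arr), hsec α hα]; rfl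
    rw [tsum_eq_sum (fun β hβ => hsupp β hβ), Finset.sum_image
      (fun a _ b _ hab => Subtype.ext (hinj a.1 a.2 b.1 b.2 hab)), ← Finset.sum_attach F]
    refine Finset.sum_congr rfl fun a _ => ?_
    rw [dif_pos (hsec a.1 a.2), ← hHh]
    congr 1
    exact Subtype.ext (Prod.ext rfl (hσ a.1 a.2))
  have hev : (fun z => ∑' α : Fiber (p z), h z α) =ᶠ[𝓝 z₀]
      fun z => ∑ α ∈ F, if hα : (τ α z).src = p z then H ⟨(z, τ α z), hα⟩ else 0 := by
    filter_upwards [ev1, ev2] with z h1 h2 using key z h1 h2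
  refine ContinuousAt.congr ?_ hev.symm
  refine tendsto_finsetSum _ fun α hα => ?_
  -- continuity of a single summand at `z₀`
  let D : Set Z := {z | (τ α z).src = p z}
  have hD : D ∈ 𝓝 z₀ := by
    filter_upwards [ev2] with z h2 using hes _ _ (h2 α hα).1
  have hz₀D : z₀ ∈ D := mem_of_mem_nhds hD
  have hcont : ContinuousAt (fun z : D => H ⟨(z.1, τ α z.1), z.2⟩) ⟨z₀, hz₀D⟩ := by
    refine ContinuousAt.comp (f := fun z : D =>
      (⟨(z.1, τ α z.1), z.2⟩ : {q : Z × Arr X // q.2.src = p q.1})) hH.continuousAt ?_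
    rw [ContinuousAt, tendsto_subtype_rng]
    exact (continuousAt_subtype_val).prodMk
      (ContinuousAt.comp (g := τ α) (f := Subtype.val) (hτc α) continuousAt_subtype_val)
  have hm := map_nhds_subtype_coe_eq_nhds hz₀D hD
  rw [← hm, tendsto_map'_iff]
  have h2 : (if hα : (τ α z₀).src = p z₀ then H ⟨(z₀, τ α z₀), hα⟩ else 0) =
      H ⟨(z₀, τ α z₀), hz₀D⟩ := dif_pos hz₀D
  rw [h2]
  refine Tendsto.congr (fun z => ?_) hcont
  exact (dif_pos (c := (τ α z.1).src = p z.1) (t := fun h => H ⟨(z.1, τ α z.1), h⟩) z.2).symm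

/-- The Hilbert space `ℓ²(𝒢ₓ)`. -/
abbrev Ell2 {X : Type u} [Groupoid.{v} X] (x : X) : Type (max u v) := lp (fun _ : Fiber x => ℂ) 2

/-- The Banach space of bounded families in `∏ₓ ℓ²(𝒢ₓ)`, with the supremum norm. -/
abbrev Fam (X : Type u) [Groupoid.{v} X] : Type (max u v) := lp (fun x : X => Ell2 x) ∞

theorem Ell2.norm_le_of_finset {x : X} (v : Ell2 x) (s : Finset (Fiber x)) (hs : ∀ α ∉ s, v α = 0)
    {C : ℝ} (hC : ∀ α, ‖v α‖ ≤ C) : ‖v‖ ≤ s.card * C := by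
  classical
  have : v = ∑ α ∈ s, lp.single 2 α (v α) := by
    ext β
    rw [lp.coeFn_sum, Finset.sum_apply]
    by_cases hβ : β ∈ s
    · rw [Finset.sum_eq_single β]
      · simp
      · intro b _ hb; exact lp.single_apply_ne _ _ _ hb.symm
      · intro h; exact absurd hβ h
    · rw [hs β hβ, Finset.sum_eq_zero]
      intro b hb
      exact lp.single_apply_ne _ _ _ (fun h => hβ (h ▸ hb))
  rw [this]
  refine (norm_sum_le _ _).trans ?_
  rw [← nsmul_eq_mul]
  refine Finset.sum_le_card_nsmul _ _ _ fun α _ => ?_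
  rw [lp.norm_single (by norm_num)]
  exact hC α

theorem cc_finite (η : C_c(Arr X, ℂ)) (x : X) : {α : Fiber x | η α.arr ≠ 0}.Finite :=
  (finite_fiber η.hasCompactSupport x).subset fun _ hα => subset_tsupport _ hα

theorem cc_memℓp (η : C_c(Arr X, ℂ)) (x : X) : Memℓp (fun α : Fiber x => η α.arr) 2 :=
  (memℓp_zero (cc_finite η x)).of_exponent_ge (by simp)

theorem cc_bounded (η : C_c(Arr X, ℂ)) : ∃ C : ℝ, 0 ≤ C ∧ ∀ γ, ‖η γ‖ ≤ C := by
  obtain ⟨C, hC⟩ := η.hasCompactSupport.exists_bound_of_continuous η.continuous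
  exact ⟨max C 0, le_max_right _ _, fun γ => (hC γ).trans (le_max_left _ _)⟩

theorem cc_card (η : C_c(Arr X, ℂ)) : ∃ N : ℕ, ∀ x, (cc_finite η x).toFinset.card ≤ N := by
  obtain ⟨N, hN⟩ := exists_card_bound (X := X) η.hasCompactSupport
  refine ⟨N, fun x => ?_⟩
  have h := (Set.encard_le_encard (show {α : Fiber x | η α.arr ≠ 0} ⊆ _ from
    fun _ hα => subset_tsupport (η : Arr X → ℂ) hα)).trans (hN x)
  rw [(cc_finite η x).encard_eq_coe_toFinset_card] at h
  exact_mod_cast h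

theorem cc_memℓp_top (η : C_c(Arr X, ℂ)) :
    Memℓp (fun x : X => (⟨fun α => η α.arr, cc_memℓp η x⟩ : Ell2 x)) ∞ := by
  obtain ⟨C, hC0, hC⟩ := cc_bounded η
  obtain ⟨N, hN⟩ := cc_card η
  apply memℓp_infty
  refine ⟨N * C, ?_⟩
  rintro _ ⟨x, rfl⟩
  refine (Ell2.norm_le_of_finset _ (cc_finite η x).toFinset (fun α hα => ?_)
    (fun α => hC α.arr)).trans ?_
  · simpa using hα
  · gcongr; exact hN x

/-- A function `η ∈ C_c(𝒢)` as the bounded family of its restrictions `η|_{𝒢ₓ} ∈ ℓ²(𝒢ₓ)`. -/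
noncomputable def ofCc : C_c(Arr X, ℂ) →ₗ[ℂ] Fam X where
  toFun η := ⟨fun x => ⟨fun α => η α.arr, cc_memℓp η x⟩, cc_memℓp_top η⟩
  map_add' _ _ := rfl
  map_smul' _ _ := rfl

@[simp] theorem ofCc_apply (η : C_c(Arr X, ℂ)) (x : X) (α : Fiber x) :
    ofCc η x α = η α.arr := rfl

variable (X) in
/-- The closure of `C_c(𝒢)` for the norm `‖ξ‖ = supₓ ‖ξ|_{𝒢ₓ}‖`. -/
noncomputable def l2Submodule : Submodule ℂ (Fam X) := (ofCc (X := X)).range.topologicalClosure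

variable (X) in
/-- The Hilbert `C₀(𝒢⁽⁰⁾)`-module `L²(𝒢)`: the completion of `C_c(𝒢)` for the norm
`‖ξ‖² = supₓ ∑_{γ ∈ 𝒢ₓ} |ξ(γ)|²`, realised as a closed subspace of the bounded families in
`∏ₓ ℓ²(𝒢ₓ)`. -/
abbrev L2 : Type (max u v) := l2Submodule X

instance : CompleteSpace (L2 X) :=
  (Submodule.isClosed_topologicalClosure (ofCc (X := X)).range).completeSpace_coe

/-- A vector of `L²(𝒢)` as a function on `𝒢`. -/
noncomputable def L2.toFun (ξ : L2 X) (γ : Arr X) : ℂ := ξ.1 γ.src γ.toFiber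

/-- `C_c(𝒢) ⊆ L²(𝒢)`. -/
noncomputable def L2.ofCc (η : C_c(Arr X, ℂ)) : L2 X :=
  ⟨EtaleGroupoid.ofCc η, Submodule.le_topologicalClosure _ ⟨η, rfl⟩⟩

theorem L2.toFun_ofCc (η : C_c(Arr X, ℂ)) (γ : Arr X) : (L2.ofCc η).toFun γ = η γ := rfl

theorem L2.toFun_injective : Function.Injective (L2.toFun : L2 X → Arr X → ℂ) := by
  intro ξ η h
  apply Subtype.ext
  ext x α
  exact congrFun h α.arr

theorem mem_l2_of_closed {p : Fam X → Prop} (hp : IsClosed {ξ | p ξ})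
    (h : ∀ η : C_c(Arr X, ℂ), p (ofCc η)) (ξ : Fam X) (hξ : ξ ∈ l2Submodule X) : p ξ := by
  have : (l2Submodule X : Set (Fam X)) ⊆ {ξ | p ξ} := by
    rw [l2Submodule, Submodule.topologicalClosure_coe]
    refine closure_minimal ?_ hp
    rintro _ ⟨η, rfl⟩
    exact h η
  exact this hξ

theorem map_mem_l2 (R : Fam X →L[ℂ] Fam X)
    (h : ∀ η : C_c(Arr X, ℂ), R (ofCc η) ∈ l2Submodule X) (ξ : Fam X)
    (hξ : ξ ∈ l2Submodule X) : R ξ ∈ l2Submodule X :=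
  mem_l2_of_closed (p := fun ξ => R ξ ∈ l2Submodule X)
    ((Submodule.isClosed_topologicalClosure _).preimage R.continuous) h ξ hξ

/-! ### The `C₀(𝒢⁽⁰⁾)`-valued inner product -/

theorem isC0_of_approx (F : X → ℂ)
    (h : ∀ ε > 0, ∃ G : C₀(X, ℂ), ∀ x, ‖F x - G x‖ ≤ ε) :
    Continuous F ∧ Tendsto F (cocompact X) (𝓝 0) := by
  constructor
  · refine continuous_of_uniform_approx_of_continuous fun U hU => ?_
    obtain ⟨ε, hε, hU⟩ := Metric.mem_uniformity_dist.1 hU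
    obtain ⟨G, hG⟩ := h (ε / 2) (half_pos hε)
    refine ⟨G, G.continuous, fun x => hU ?_⟩
    rw [dist_eq_norm]
    exact (hG x).trans_lt (half_lt_self hε)
  · rw [Metric.tendsto_nhds]
    intro ε hε
    obtain ⟨G, hG⟩ := h (ε / 2) (half_pos hε)
    have := G.zero_at_infty'
    rw [Metric.tendsto_nhds] at this
    filter_upwards [this (ε / 2) (half_pos hε)] with x hx
    rw [dist_zero_right] at hx ⊢
    calc ‖F x‖ = ‖(F x - G x) + G x‖ := by simp
      _ ≤ ‖F x - G x‖ + ‖G x‖ := norm_add_le _ _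
      _ < ε / 2 + ε / 2 := add_lt_add_of_le_of_lt (hG x) hx
      _ = ε := by ring

/-- The function `x ↦ ⟨η|_{𝒢ₓ}, ξ|_{𝒢ₓ}⟩ = ∑_{γ ∈ 𝒢ₓ} conj η(γ) ξ(γ)`. -/
noncomputable def innerFun (η ξ : Fam X) (x : X) : ℂ := inner ℂ (η x) (ξ x)

theorem innerFun_eq_tsum (η ξ : Fam X) (x : X) :
    innerFun η ξ x = ∑' α : Fiber x, conj (η x α) * ξ x α := by
  rw [innerFun, lp.inner_eq_tsum]
  refine tsum_congr fun α => ?_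
  rw [RCLike.inner_apply, mul_comm]

theorem innerFun_cc (η ξ : C_c(Arr X, ℂ)) :
    ∃ G : C₀(X, ℂ), ∀ x, innerFun (ofCc η) (ofCc ξ) x = G x := by
  have := t2Space_units X
  have hs : Continuous (Arr.src : Arr X → X) := continuous_src
  have hK : IsCompact (tsupport ξ) := ξ.hasCompactSupport
  have hc : Continuous (innerFun (ofCc η) (ofCc ξ)) := by
    have : innerFun (ofCc η) (ofCc ξ) =
        fun x => ∑' α : Fiber (id x), conj (η α.arr) * ξ α.arr := by
      funext x; exact innerFun_eq_tsum _ _ _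
    rw [this]
    refine continuous_fiberSum id continuous_id hK (fun x α => conj (η α.arr) * ξ α.arr)
      (fun q => conj (η q.1.2) * ξ q.1.2) ?_ (fun _ _ => rfl) ?_
    · have h2 : Continuous fun q : {q : X × Arr X // q.2.src = id q.1} => q.1.2 :=
        continuous_snd.comp continuous_subtype_val
      exact (Complex.continuous_conj.comp (η.continuous.comp h2)).mul (ξ.continuous.comp h2)
    · intro z α hα
      rw [image_eq_zero_of_notMem_tsupport hα, mul_zero]
  refine ⟨⟨⟨_, hc⟩, ?_⟩, fun _ => rfl⟩
  have : HasCompactSupport (innerFun (ofCc η) (ofCc ξ)) := by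
    refine HasCompactSupport.intro (hK.image hs) fun x hx => ?_
    rw [innerFun_eq_tsum]
    refine (tsum_congr fun α => ?_).trans tsum_zero
    have : α.arr ∉ tsupport ξ := fun h => hx ⟨_, h, rfl⟩
    rw [ofCc_apply, ofCc_apply, image_eq_zero_of_notMem_tsupport this, mul_zero]
  exact this.is_zero_at_infty

theorem norm_innerFun_le (η ξ : Fam X) (x : X) : ‖innerFun η ξ x‖ ≤ ‖η‖ * ‖ξ‖ :=
  (norm_inner_le_norm _ _).trans (mul_le_mul (lp.norm_apply_le_norm (by simp) _ _)
    (lp.norm_apply_le_norm (by simp) _ _) (norm_nonneg _) (norm_nonneg _))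

theorem innerFun_sub_right (η ξ ζ : Fam X) (x : X) :
    innerFun η ξ x - innerFun η ζ x = innerFun η (ξ - ζ) x := (inner_sub_right _ _ _).symm

theorem innerFun_symm (η ξ : Fam X) (x : X) : conj (innerFun η ξ x) = innerFun ξ η x :=
  inner_conj_symm _ _

theorem isClosed_isC0 (η : Fam X) :
    IsClosed {ξ : Fam X | ∃ G : C₀(X, ℂ), ∀ x, innerFun η ξ x = G x} := by
  rw [← closure_subset_iff_isClosed]
  intro ξ hξ
  have h := isC0_of_approx (innerFun η ξ) fun ε hε => by
    obtain ⟨ζ, ⟨G, hG⟩, hζ⟩ := Metric.mem_closure_iff.1 hξ (ε / (‖η‖ + 1)) (by positivity)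
    refine ⟨G, fun x => ?_⟩
    rw [← hG, innerFun_sub_right]
    refine (norm_innerFun_le _ _ _).trans ?_
    rw [dist_eq_norm] at hζ
    calc ‖η‖ * ‖ξ - ζ‖ ≤ (‖η‖ + 1) * (ε / (‖η‖ + 1)) := by
          gcongr; linarith
      _ = ε := by field_simp
  exact ⟨⟨⟨_, h.1⟩, h.2⟩, fun _ => rfl⟩

theorem innerFun_l2 (η ξ : L2 X) : ∃ G : C₀(X, ℂ), ∀ x, innerFun η.1 ξ.1 x = G x := by
  refine mem_l2_of_closed (isClosed_isC0 η.1) (fun ζ => ?_) ξ.1 ξ.2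
  have : ∃ G : C₀(X, ℂ), ∀ x, innerFun (ofCc ζ) η.1 x = G x :=
    mem_l2_of_closed (isClosed_isC0 _) (fun ζ' => innerFun_cc ζ ζ') η.1 η.2
  obtain ⟨G, hG⟩ := this
  refine ⟨star G, fun x => ?_⟩
  rw [← innerFun_symm, hG]
  rfl

/-! ### The action of `C₀(𝒢⁽⁰⁾)` -/

/-- The family `x ↦ f(x) ξ|_{𝒢ₓ}`. -/
noncomputable def smulFam (f : C₀(X, ℂ)) : Fam X →L[ℂ] Fam X :=
  LinearMap.mkContinuous
    { toFun := fun ξ => ⟨fun x => f x • ξ x, memℓp_infty ⟨‖f‖ * ‖ξ‖, by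
        rintro _ ⟨x, rfl⟩
        refine (norm_smul (f x) (ξ x)).le.trans ?_
        exact mul_le_mul (f.toBCF.norm_coe_le_norm x) (lp.norm_apply_le_norm (by simp) _ _)
          (norm_nonneg _) (norm_nonneg _)⟩⟩
      map_add' := fun ξ η => by ext x : 2; exact smul_add _ _ _
      map_smul' := fun c ξ => by ext x : 2; exact smul_comm (f x) c (ξ x) } ‖f‖ fun ξ => by
    refine lp.norm_le_of_forall_le (by positivity) fun x => ?_
    refine (norm_smul _ _).le.trans ?_
    exact mul_le_mul (f.toBCF.norm_coe_le_norm x) (lp.norm_apply_le_norm (by simp) _ _)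
      (norm_nonneg _) (norm_nonneg _)

theorem smulFam_apply (f : C₀(X, ℂ)) (ξ : Fam X) (x : X) : smulFam f ξ x = f x • ξ x := rfl

theorem smulFam_mem (f : C₀(X, ℂ)) (ξ : L2 X) : smulFam f ξ.1 ∈ l2Submodule X := by
  have hs : Continuous (Arr.src : Arr X → X) := continuous_src
  refine map_mem_l2 (smulFam f) (fun η => ?_) ξ.1 ξ.2
  let ζ : C_c(Arr X, ℂ) := ⟨⟨fun γ => f γ.src * η γ, (f.continuous.comp hs).mul η.continuous⟩,
    η.hasCompactSupport.mul_left⟩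
  have : smulFam f (ofCc η) = ofCc ζ := rfl
  rw [this]
  exact (L2.ofCc ζ).2

/-- The module structure `(ξ f)(γ) = ξ(γ) f(s(γ))`. -/
noncomputable instance : SMul C₀(X, ℂ) (L2 X) := ⟨fun f ξ => ⟨smulFam f ξ.1, smulFam_mem f ξ⟩⟩

/-- The pointwise order of the `C^*`-algebra `C₀(X)`. -/
noncomputable instance : PartialOrder C₀(X, ℂ) := PartialOrder.lift (fun f => (f : X → ℂ)) DFunLike.coe_injective

/-- `L²(𝒢)` is a Hilbert module over `C₀(𝒢⁽⁰⁾)`, with inner product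
`⟨η, ξ⟩(x) = ∑_{γ ∈ 𝒢ₓ} conj η(γ) ξ(γ)`. -/
noncomputable instance : CStarModule C₀(X, ℂ) (L2 X) where
  inner η ξ :=
    { toFun := innerFun η.1 ξ.1
      continuous_toFun := by
        obtain ⟨G, hG⟩ := innerFun_l2 η ξ
        rw [funext hG]; exact G.continuous
      zero_at_infty' := by
        obtain ⟨G, hG⟩ := innerFun_l2 η ξ
        have := G.zero_at_infty'
        rwa [show (G.toFun : X → ℂ) = innerFun η.1 ξ.1 from (funext hG).symm] at this }
  inner_add_right := by
    intro x y z; ext t; exact inner_add_right (𝕜 := ℂ) (x.1 t) (y.1 t) (z.1 t)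
  inner_self_nonneg := by
    intro ξ t
    change 0 ≤ inner ℂ (ξ.1 t) (ξ.1 t)
    rw [inner_self_eq_norm_sq_to_K]
    exact pow_nonneg (RCLike.ofReal_nonneg.2 (norm_nonneg (ξ.1 t))) 2
  inner_self := by
    intro ξ
    constructor
    · intro h
      apply Subtype.ext
      ext t : 2
      have := DFunLike.congr_fun h t
      exact inner_self_eq_zero.1 this
    · rintro rfl
      ext t
      exact inner_zero_right (𝕜 := ℂ) ((0 : L2 X).1 t)
  inner_op_smul_right := by
    intro f η ξ; ext t; exact inner_smul_right (𝕜 := ℂ) (η.1 t) (ξ.1 t) (f t)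
  inner_smul_right_complex := by
    intro z η ξ; ext t; exact inner_smul_right (𝕜 := ℂ) (η.1 t) (ξ.1 t) z
  star_inner := by
    intro η ξ; ext t; exact inner_conj_symm (𝕜 := ℂ) (ξ.1 t) (η.1 t)
  norm_eq_sqrt_norm_inner_self := by
    intro ξ
    change ‖ξ.1‖ = √ _
    have hn : ∀ x, ‖innerFun ξ.1 ξ.1 x‖ = ‖ξ.1 x‖ ^ 2 := fun x => by
      rw [innerFun, inner_self_eq_norm_sq_to_K]; simp
    apply le_antisymm
    · refine lp.norm_le_of_forall_le (Real.sqrt_nonneg _) fun x => Real.le_sqrt_of_sq_le ?_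
      rw [← hn]
      exact BoundedContinuousFunction.norm_coe_le_norm
        (ZeroAtInftyContinuousMap.toBCF (β := ℂ) ⟨⟨innerFun ξ.1 ξ.1, _⟩, _⟩) x
    · rw [Real.sqrt_le_left (norm_nonneg _), ← ZeroAtInftyContinuousMap.norm_toBCF_eq_norm,
        BoundedContinuousFunction.norm_le (sq_nonneg _)]
      intro x
      refine (hn x).le.trans ?_
      gcongr
      exact lp.norm_apply_le_norm (by simp) ξ.1 x

theorem inner_apply (η ξ : L2 X) (x : X) :
    (inner C₀(X, ℂ) η ξ) x = ∑' α : Fiber x, conj (η.toFun α.arr) * ξ.toFun α.arr :=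
  innerFun_eq_tsum _ _ _

/-! ### Restriction to the fibres -/

/-- The restriction `φₓ : L²(𝒢) → ℓ²(𝒢ₓ)`, `ξ ↦ ξ|_{𝒢ₓ}`. -/
noncomputable def restr (x : X) : L2 X →L[ℂ] Ell2 x :=
  (lp.evalCLM ℂ (fun x : X => Ell2 x) ∞ x).comp (l2Submodule X).subtypeL

theorem restr_apply (x : X) (ξ : L2 X) (α : Fiber x) : restr x ξ α = ξ.toFun α.arr := rfl

theorem restr_eq (x : X) (ξ : L2 X) : restr x ξ = ξ.1 x := rfl

theorem exists_cc_single [DecidableEq X] {x : X} [DecidableEq (Fiber x)] (α : Fiber x) :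
    ∃ η : C_c(Arr X, ℂ), restr x (L2.ofCc η) = lp.single 2 α (1 : ℂ) := by
  obtain ⟨e, he, heq⟩ := isLocalHomeomorph_src (X := X) α.arr
  obtain ⟨f, hf1, hf0, hfc, -⟩ := exists_continuous_one_zero_of_isCompact
    (isCompact_singleton (x := α.arr)) e.open_source.isClosed_compl
    (Set.disjoint_singleton_left.2 (fun h => h he))
  let η : C_c(Arr X, ℂ) := ⟨⟨fun γ => (f γ : ℂ), Complex.continuous_ofReal.comp f.continuous⟩,
    hfc.comp_left (g := Complex.ofReal) Complex.ofReal_zero⟩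
  refine ⟨η, ?_⟩
  ext β
  change ((f β.arr : ℝ) : ℂ) = _
  by_cases h : β = α
  · subst h
    rw [lp.single_apply_self, hf1 (Set.mem_singleton _)]; simp
  · rw [lp.single_apply_ne _ _ _ h, hf0]
    · simp
    · intro hβ
      apply h
      apply Fiber.arr_injective
      apply e.injOn hβ he
      rw [← heq]; rfl

theorem exists_restr_norm_le (x : X) (ξ : L2 X) :
    ∃ ξ' : L2 X, restr x ξ' = restr x ξ ∧ ‖ξ'‖ ≤ 2 * ‖restr x ξ‖ := by
  have := t2Space_units X
  have := locallyCompactSpace_units X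
  by_cases h0 : restr x ξ = 0
  · exact ⟨0, by rw [map_zero, h0], by simp⟩
  have hn : ∀ y, (innerFun ξ.1 ξ.1 y) = (‖ξ.1 y‖ : ℂ) ^ 2 := fun y => by
    rw [innerFun, inner_self_eq_norm_sq_to_K]; rfl
  have hcont : Continuous fun y => ‖ξ.1 y‖ := by
    have h1 : Continuous (innerFun ξ.1 ξ.1) := (inner C₀(X, ℂ) ξ ξ).continuous
    have h2 : (fun y => ‖ξ.1 y‖) = fun y => √‖innerFun ξ.1 ξ.1 y‖ := by
      funext y; rw [hn]; simp
    rw [h2]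
    exact Real.continuous_sqrt.comp h1.norm
  have hw : 0 < ‖restr x ξ‖ := norm_pos_iff.2 h0
  let U : Set X := {y | ‖ξ.1 y‖ < 2 * ‖restr x ξ‖}
  have hU : IsOpen U := isOpen_lt hcont continuous_const
  have hxU : x ∈ U := by
    change ‖restr x ξ‖ < _
    linarith
  obtain ⟨f, hf1, hf0, hfc, hf⟩ := exists_continuous_one_zero_of_isCompact
    (isCompact_singleton (x := x)) hU.isClosed_compl
    (Set.disjoint_singleton_left.2 (fun h => h hxU))
  let g : C₀(X, ℂ) := ⟨⟨fun y => (f y : ℂ), Complex.continuous_ofReal.comp f.continuous⟩,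
    (hfc.comp_left (g := Complex.ofReal) Complex.ofReal_zero).is_zero_at_infty⟩
  refine ⟨g • ξ, ?_, ?_⟩
  · change ((f x : ℝ) : ℂ) • ξ.1 x = ξ.1 x
    rw [hf1 (Set.mem_singleton _)]; simp
  · change ‖smulFam g ξ.1‖ ≤ _
    refine lp.norm_le_of_forall_le (by positivity) fun y => ?_
    rw [smulFam_apply]
    refine (norm_smul _ _).le.trans ?_
    change ‖((f y : ℝ) : ℂ)‖ * _ ≤ _
    by_cases hy : y ∈ U
    · rw [Complex.norm_real, Real.norm_of_nonneg (hf y).1]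
      calc f y * ‖ξ.1 y‖ ≤ 1 * (2 * ‖restr x ξ‖) :=
            mul_le_mul (hf y).2 (le_of_lt hy) (norm_nonneg _) zero_le_one
        _ = _ := one_mul _
    · rw [hf0 hy]; simp

/-- The restriction maps are surjective. -/
theorem restr_surjective (x : X) : Function.Surjective (restr x : L2 X → Ell2 x) := by
  classical
  let φ : NormedAddGroupHom (L2 X) (Ell2 x) :=
    (restr x).toLinearMap.toAddMonoidHom.mkNormedAddGroupHom ‖restr (X := X) x‖
      (restr x).le_opNorm
  have h : φ.SurjectiveOnWith φ.range 2 := by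
    rintro _ ⟨ξ, rfl⟩
    obtain ⟨ξ', h1, h2⟩ := exists_restr_norm_le x ξ
    exact ⟨ξ', h1, h2⟩
  have h2 := controlled_closure_of_complete (by norm_num) one_pos h
  intro v
  have hv : v ∈ φ.range.topologicalClosure := by
    have hs := lp.hasSum_single (p := 2) (by simp) v
    refine isClosed_closure.mem_of_tendsto hs (Eventually.of_forall fun s => subset_closure ?_)
    refine sum_mem fun α _ => ?_
    obtain ⟨η, hη⟩ := exists_cc_single α
    refine ⟨v α • L2.ofCc η, ?_⟩
    change restr x (v α • L2.ofCc η) = _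
    rw [map_smul, hη, ← lp.single_smul]
    simp
  obtain ⟨ξ, hξ, -⟩ := h2 v hv
  exact ⟨ξ, hξ⟩

/-! ### Adjointable operators and their slices -/

/-- `T : L²(𝒢) → L²(𝒢)` is adjointable: there is `S` with `⟨η, T ξ⟩ = ⟨S η, ξ⟩` in
`C₀(𝒢⁽⁰⁾)` for all `η, ξ`. -/
def IsAdjointable (T : L2 X → L2 X) : Prop :=
  ∃ S : L2 X → L2 X, ∀ η ξ : L2 X, inner C₀(X, ℂ) η (T ξ) = inner C₀(X, ℂ) (S η) ξ

variable (X) in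
/-- The set `ℒ(L²(𝒢))` of adjointable operators. -/
abbrev Adjointable : Type (max u v) := {T : L2 X → L2 X // IsAdjointable T}

theorem inner_restr (η ξ : L2 X) (x : X) :
    (inner C₀(X, ℂ) η ξ) x = inner ℂ (restr x η) (restr x ξ) := rfl

/-- The restriction of `T ξ` to `𝒢ₓ` is linear in, and determined by, the restriction of `ξ`. -/
theorem slice_welldefined (T : Adjointable X) (x : X) (a b : ℂ) (ξ ζ ω : L2 X)
    (h : restr x ω = a • restr x ξ + b • restr x ζ) :
    restr x (T.1 ω) = a • restr x (T.1 ξ) + b • restr x (T.1 ζ) := by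
  obtain ⟨S, hS⟩ := T.2
  have hS' : ∀ η ξ : L2 X, inner ℂ (restr x η) (restr x (T.1 ξ)) =
      inner ℂ (restr x (S η)) (restr x ξ) := fun η ξ => by
    rw [← inner_restr, hS, inner_restr]
  refine ext_inner_left ℂ fun v => ?_
  obtain ⟨η, rfl⟩ := restr_surjective x v
  rw [hS', h, inner_add_right, inner_add_right, inner_smul_right, inner_smul_right,
    inner_smul_right, inner_smul_right, hS', hS']

/-- The slice `Φₓ(T)` as a linear map on `ℓ²(𝒢ₓ)`, determined by `Φₓ(T)(ξ|_{𝒢ₓ}) = (T ξ)|_{𝒢ₓ}`. -/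
noncomputable def sliceLin (T : Adjointable X) (x : X) : Ell2 x →ₗ[ℂ] Ell2 x where
  toFun v := restr x (T.1 (Function.surjInv (restr_surjective x) v))
  map_add' v w := by
    have := slice_welldefined T x 1 1 (Function.surjInv (restr_surjective x) v)
      (Function.surjInv (restr_surjective x) w) (Function.surjInv (restr_surjective x) (v + w))
      (by simp only [Function.surjInv_eq, one_smul])
    simpa only [one_smul] using this
  map_smul' c v := by
    have := slice_welldefined T x c 0 (Function.surjInv (restr_surjective x) v) 0
      (Function.surjInv (restr_surjective x) (c • v))
      (by simp only [Function.surjInv_eq, zero_smul, add_zero])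
    rw [zero_smul, add_zero] at this
    exact this

theorem sliceLin_apply (T : Adjointable X) (x : X) (ξ : L2 X) :
    sliceLin T x (restr x ξ) = restr x (T.1 ξ) := by
  have := slice_welldefined T x 1 0 ξ 0 (Function.surjInv (restr_surjective x) (restr x ξ))
    (by simp only [Function.surjInv_eq, one_smul, zero_smul, add_zero])
  rw [one_smul, zero_smul, add_zero] at this
  exact this

/-- The slice `Φₓ(T) ∈ ℬ(ℓ²(𝒢ₓ))` of `T ∈ ℒ(L²(𝒢))` at `x`, the operator with
`Φₓ(T)(ξ|_{𝒢ₓ}) = (T ξ)|_{𝒢ₓ}` for all `ξ ∈ L²(𝒢)`. -/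
noncomputable def slice (T : Adjointable X) (x : X) : Ell2 x →L[ℂ] Ell2 x where
  toLinearMap := sliceLin T x
  cont := by
    obtain ⟨S, hS⟩ := T.2
    have hS' : ∀ (η : L2 X) (v : Ell2 x), inner ℂ (restr x η) (sliceLin T x v) =
        inner ℂ (restr x (S η)) v := fun η v => by
      obtain ⟨ξ, rfl⟩ := restr_surjective x v
      rw [sliceLin_apply, ← inner_restr, hS, inner_restr]
    refine (sliceLin T x).continuous_of_seq_closed_graph fun u v w hu hw => ?_
    refine ext_inner_left ℂ fun y => ?_
    obtain ⟨η, rfl⟩ := restr_surjective x y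
    have h1 : Tendsto (fun n => inner ℂ (restr x η) ((sliceLin T x ∘ u) n)) atTop
        (𝓝 (inner ℂ (restr x η) w)) := tendsto_const_nhds.inner hw
    have h2 : Tendsto (fun n => inner ℂ (restr x η) ((sliceLin T x ∘ u) n)) atTop
        (𝓝 (inner ℂ (restr x η) (sliceLin T x v))) := by
      simp only [Function.comp_apply, hS']
      exact tendsto_const_nhds.inner hu
    exact tendsto_nhds_unique h1 h2

theorem slice_apply (T : Adjointable X) (x : X) (ξ : L2 X) :
    slice T x (restr x ξ) = restr x (T.1 ξ) := sliceLin_apply T x ξ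

/-! ### Right convolution and equivariance -/

/-- Right translation of the fibres by `β : x ⟶ y`: the bijection `𝒢ₓ → 𝒢_y`, `γ ↦ γ β⁻¹`. -/
def transl {x y : X} (β : x ⟶ y) : Fiber x ≃ Fiber y where
  toFun γ := ⟨γ.1, Groupoid.inv β ≫ γ.2⟩
  invFun γ := ⟨γ.1, β ≫ γ.2⟩
  left_inv γ := by cases γ; simp
  right_inv γ := by cases γ; simp

/-- The operator `ℓ²(𝒢_y) → ℓ²(𝒢ₓ)`, `v ↦ (γ ↦ v(γ β⁻¹))`, for `β : x ⟶ y`. -/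
noncomputable def translOp {x y : X} (β : x ⟶ y) (v : Ell2 y) : Ell2 x :=
  ⟨fun γ => v (transl β γ), by
    have := (memℓp_gen_iff (p := 2) (by simp)).1 (lp.memℓp v)
    exact memℓp_gen ((transl β).summable_iff.2 this)⟩

theorem norm_translOp {x y : X} (β : x ⟶ y) (v : Ell2 y) : ‖translOp β v‖ = ‖v‖ := by
  rw [lp.norm_eq_tsum_rpow (by simp), lp.norm_eq_tsum_rpow (by simp)]
  congr 1
  exact (transl β).tsum_eq (fun γ => ‖v γ‖ ^ (2 : ℝ≥0∞).toReal)

/-- Right convolution by `g` on bounded families. -/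
noncomputable def rhoFamAt (g : C_c(Arr X, ℂ)) (ξ : Fam X) (x : X) : Ell2 x :=
  ∑ β ∈ (cc_finite g x).toFinset, g β.arr • translOp β.2 (ξ β.1)

theorem exists_rhoFam_bound (g : C_c(Arr X, ℂ)) :
    ∃ C : ℝ, 0 ≤ C ∧ ∀ (ξ : Fam X) (x : X), ‖rhoFamAt g ξ x‖ ≤ C * ‖ξ‖ := by
  obtain ⟨C, hC0, hC⟩ := cc_bounded g
  obtain ⟨N, hN⟩ := cc_card g
  refine ⟨N * C, by positivity, fun ξ x => ?_⟩
  refine (norm_sum_le _ _).trans ((Finset.sum_le_card_nsmul _ _ (C * ‖ξ‖) fun β _ => ?_).trans ?_)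
  · rw [norm_smul, norm_translOp]
    exact mul_le_mul (hC _) (lp.norm_apply_le_norm (by simp) _ _) (norm_nonneg _) hC0
  · rw [nsmul_eq_mul, mul_assoc]
    gcongr
    exact hN x

/-- Right convolution by `g` on bounded families, as a bounded operator. -/
noncomputable def rhoFam (g : C_c(Arr X, ℂ)) : Fam X →L[ℂ] Fam X :=
  LinearMap.mkContinuousOfExistsBound
    { toFun := fun ξ => ⟨rhoFamAt g ξ, memℓp_infty (by
        obtain ⟨C, -, hC⟩ := exists_rhoFam_bound g
        exact ⟨C * ‖ξ‖, by rintro _ ⟨x, rfl⟩; exact hC ξ x⟩)⟩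
      map_add' := fun ξ η => by
        ext x : 2
        change ∑ β ∈ (cc_finite g x).toFinset, g β.arr • translOp β.2 (ξ β.1 + η β.1) =
          ∑ β ∈ (cc_finite g x).toFinset, g β.arr • translOp β.2 (ξ β.1) +
          ∑ β ∈ (cc_finite g x).toFinset, g β.arr • translOp β.2 (η β.1)
        rw [← Finset.sum_add_distrib]
        exact Finset.sum_congr rfl fun β _ =>
          smul_add (g β.arr) (translOp β.2 (ξ β.1)) (translOp β.2 (η β.1))
      map_smul' := fun c ξ => by
        ext x : 2
        change ∑ β ∈ (cc_finite g x).toFinset, g β.arr • translOp β.2 (c • ξ β.1) =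
          c • ∑ β ∈ (cc_finite g x).toFinset, g β.arr • translOp β.2 (ξ β.1)
        rw [Finset.smul_sum]
        exact Finset.sum_congr rfl fun β _ => smul_comm (g β.arr) c (translOp β.2 (ξ β.1)) }
    (by
      obtain ⟨C, hC0, hC⟩ := exists_rhoFam_bound g
      exact ⟨C, fun ξ => lp.norm_le_of_forall_le (by positivity) (hC ξ)⟩)

theorem rhoFam_apply (g : C_c(Arr X, ℂ)) (ξ : Fam X) (γ : Arr X) :
    rhoFam g ξ γ.src γ.toFiber =
      ∑' β : Fiber γ.src, ξ (γ.mulInv β).src (γ.mulInv β).toFiber * g β.arr := by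
  change (∑ β ∈ (cc_finite g γ.src).toFinset, g β.arr • translOp β.2 (ξ β.1)) γ.toFiber = _
  rw [lp.coeFn_sum, Finset.sum_apply, tsum_eq_sum (s := (cc_finite g γ.src).toFinset)]
  · exact Finset.sum_congr rfl fun β _ => mul_comm _ _
  · intro β hβ
    have : g β.arr = 0 := by simpa using hβ
    rw [this, mul_zero]

/-- `C_c(𝒢)` is closed under convolution. -/
theorem exists_cc_conv (f g : C_c(Arr X, ℂ)) : ∃ h : C_c(Arr X, ℂ), ⇑h = conv f g := by
  have := t2Space_units X
  have hs : Continuous (Arr.src : Arr X → X) := continuous_src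
  have hc : Continuous (conv f g) := by
    refine continuous_fiberSum (Arr.src : Arr X → X) hs g.hasCompactSupport
      (fun γ α => f (γ.mulInv α) * g α.arr)
      (fun q => f (Arr.mul q.1.1 q.1.2.inv q.2.symm) * g q.1.2) ?_ ?_ ?_
    · have h1 : Continuous fun q : {q : Arr X × Arr X // q.2.src = q.1.src} =>
          (⟨(q.1.1, q.1.2.inv), q.2.symm⟩ : {p : Arr X × Arr X // p.1.src = p.2.tgt}) := by
        refine Continuous.subtype_mk ?_ _
        exact (continuous_fst.comp continuous_subtype_val).prodMk
          (continuous_inv.comp (continuous_snd.comp continuous_subtype_val))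
      exact (f.continuous.comp (continuous_mul.comp h1)).mul
        (g.continuous.comp (continuous_snd.comp continuous_subtype_val))
    · intro γ α
      simp only [Arr.mul_mulInv]
    · intro γ α hα
      rw [image_eq_zero_of_notMem_tsupport hα, mul_zero]
  refine ⟨⟨⟨conv f g, hc⟩, ?_⟩, rfl⟩
  have hK : IsCompact {p : {p : Arr X × Arr X // p.1.src = p.2.tgt} |
      p.1.1 ∈ tsupport f ∧ p.1.2 ∈ tsupport g} := by
    have hcl : IsClosed {p : Arr X × Arr X | p.1.src = p.2.tgt} :=
      isClosed_eq (hs.comp continuous_fst) (continuous_tgt.comp continuous_snd)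
    exact hcl.isClosedEmbedding_subtypeVal.isCompact_preimage
      (f.hasCompactSupport.isCompact.prod g.hasCompactSupport.isCompact)
  refine HasCompactSupport.intro (hK.image continuous_mul) fun γ hγ => ?_
  refine (tsum_congr fun α => ?_).trans tsum_zero
  by_cases hα : α.arr ∈ tsupport g
  · have : γ.mulInv α ∉ tsupport f := fun hf => hγ
      ⟨⟨(γ.mulInv α, α.arr), rfl⟩, ⟨hf, hα⟩, by simp [Arr.mul, Arr.mulInv, Fiber.arr]⟩
    rw [image_eq_zero_of_notMem_tsupport this, zero_mul]
  · rw [image_eq_zero_of_notMem_tsupport hα, mul_zero]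

theorem rhoFam_mem (g : C_c(Arr X, ℂ)) (ξ : L2 X) : rhoFam g ξ.1 ∈ l2Submodule X := by
  refine map_mem_l2 (rhoFam g) (fun η => ?_) ξ.1 ξ.2
  obtain ⟨h, hh⟩ := exists_cc_conv η g
  have : rhoFam g (ofCc η) = ofCc h := by
    ext x α
    exact (rhoFam_apply g (ofCc η) α.arr).trans (congrFun hh α.arr).symm
  rw [this]
  exact (L2.ofCc h).2

/-- The right regular representation: `ρ(g) ξ = ξ * g` for `g ∈ C_c(𝒢)` and `ξ ∈ L²(𝒢)`, a bounded
operator on the Banach space `L²(𝒢)`. -/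
noncomputable def rho (g : C_c(Arr X, ℂ)) : L2 X →L[ℂ] L2 X :=
  ((rhoFam g).comp (l2Submodule X).subtypeL).codRestrict (l2Submodule X) (rhoFam_mem g)

theorem rho_toFun (g : C_c(Arr X, ℂ)) (ξ : L2 X) : (rho g ξ).toFun = conv ξ.toFun g :=
  funext fun γ => rhoFam_apply g ξ.1 γ

/-- `T` is `𝒢`-equivariant: it commutes with the right regular representation. -/
def IsEquivariant (T : L2 X → L2 X) : Prop :=
  ∀ (g : C_c(Arr X, ℂ)) (ξ : L2 X), T (rho g ξ) = rho g (T ξ)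

/-! ### Left convolvers -/

/-- A left convolver: a function `f ∈ C_b(𝒢)` such that `f` and `f^*` are square summable on the
source fibres, with uniformly bounded norms, and such that `f * g` and `f^* * g` belong to
`L²(𝒢)` for all `g ∈ L²(𝒢)`. -/
structure IsLeftConvolver (f : Arr X →ᵇ ℂ) : Prop where
  memℓp : ∀ x : X, Memℓp (fun α : Fiber x => f α.arr) 2
  memℓp_adj : ∀ x : X, Memℓp (fun α : Fiber x => adj f α.arr) 2
  bddAbove : BddAbove (Set.range fun x : X => ‖(⟨_, memℓp x⟩ : Ell2 x)‖)
  bddAbove_adj : BddAbove (Set.range fun x : X => ‖(⟨_, memℓp_adj x⟩ : Ell2 x)‖)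
  conv_mem : ∀ g : L2 X, ∃ h : L2 X, h.toFun = conv f g.toFun
  adj_conv_mem : ∀ g : L2 X, ∃ h : L2 X, h.toFun = conv (adj f) g.toFun

/-- The operator `Λ(f) : g ↦ f * g` on `L²(𝒢)`, for a left convolver `f`. -/
noncomputable def leftConv (f : Arr X →ᵇ ℂ) (hf : IsLeftConvolver f) (g : L2 X) : L2 X :=
  (hf.conv_mem g).choose

theorem leftConv_toFun (f : Arr X →ᵇ ℂ) (hf : IsLeftConvolver f) (g : L2 X) :
    (leftConv f hf g).toFun = conv f g.toFun := (hf.conv_mem g).choose_spec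

/-- The point mass `δ_α ∈ ℓ²(𝒢ₓ)` at `α ∈ 𝒢ₓ`. -/
noncomputable def delta {x : X} (α : Fiber x) : Ell2 x :=
  open scoped Classical in lp.single 2 α (1 : ℂ)

end Topology

end EtaleGroupoid

namespace EtaleGroupoid

universe u v

section Topology

open IsLocallyCompactGroupoid IsLocallyCompactEtaleGroupoid

variable {X : Type u} [Groupoid.{v} X] [TopologicalSpace (Arr X)] [TopologicalSpace X]
  [IsLocallyCompactEtaleGroupoid X]

/-! ### Point masses and translations -/

/-! Everything is decided fibrewise: an element of `L²(𝒢)` is determined by its restrictions to the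
Hilbert spaces `ℓ²(𝒢ₓ)`, and an adjointable `T` acts there through bounded slices. If `g ∈ C_c(𝒢)`
restricts to a point mass `δ_β` on `𝒢ₓ`, then `ξ ↦ ξ * g` acts on that fibre as the single
translation by `β`. Equivariance therefore makes the slices commute with right translations
(`IsEquivariant.commutesWithTransl`).

Every point mass `δ_γ` is a translate of the one at the unit `r(γ)`, so the matrix of a slice of an
equivariant `T` is `(α, γ) ↦ f(α γ⁻¹)`, with `f` the `symbol` of `T`, formed from the columns at the
units (`CommutesWithTransl.slice_delta`). The adjoint has symbol `f^*`. Pairing `T ξ` with `δ_γ` and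
moving `T` across the inner product gives `T ξ = f * ξ` (`toFun_eq_conv_symbol`), without expanding
`ξ` in point masses. Continuity of `f` is local: near a unit all the point masses at units are
restrictions of one `η ∈ C_c(𝒢)`, so `f` locally agrees with `T η`. Boundedness of `f` and the
uniform `ℓ²` bounds come from a norm bound on the slices independent of the fibre. Evaluating `f *
g` where `g` restricts to the point mass at a unit recovers `f`, hence uniqueness.

For a left convolver `f`, square summability of `f^*` makes each value `(f * g)(γ)` an inner product
with a vector of `ℓ²`. The closed graph theorem then gives a bounded operator `fiberOp` on each
fibre; its adjoint is convolution by `f^*`, and it commutes with translations, which yields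
adjointability and equivariance. -/

/-- The unit at `x` as a point of the fibre `𝒢ₓ`. -/
def unitFiber (x : X) : Fiber x := ⟨x, 𝟙 x⟩

theorem delta_apply_self {x : X} (α : Fiber x) : delta α α = 1 := by
  classical
  exact lp.single_apply_self _ _ _

theorem delta_apply_ne {x : X} {α β : Fiber x} (h : β ≠ α) : delta α β = 0 := by
  classical
  exact lp.single_apply_ne _ _ _ h

theorem inner_delta_left {x : X} (α : Fiber x) (v : Ell2 x) : inner ℂ (delta α) v = v α := by
  classical
  rw [delta, lp.inner_single_left]
  simp

theorem inner_delta_right {x : X} (α : Fiber x) (v : Ell2 x) :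
    inner ℂ v (delta α) = conj (v α) := by
  rw [← inner_conj_symm, inner_delta_left]

theorem exists_cc_delta {x : X} (α : Fiber x) :
    ∃ η : C_c(Arr X, ℂ), restr x (L2.ofCc η) = delta α := by
  classical
  obtain ⟨η, h⟩ := exists_cc_single α
  exact ⟨η, h.trans (by rw [delta])⟩

theorem translOp_apply {x y : X} (β : x ⟶ y) (v : Ell2 y) (γ : Fiber x) :
    translOp β v γ = v (transl β γ) := rfl

theorem transl_self {x : X} (γ : Fiber x) : transl γ.2 γ = unitFiber γ.1 := by
  simp [transl, unitFiber]

theorem arr_transl {x : X} (γ α : Fiber x) : (transl α.2 γ).arr = γ.arr.mulInv α := rfl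

theorem inv_mulInv {x : X} (γ α : Fiber x) : (γ.arr.mulInv α).inv = α.arr.mulInv γ := by
  simp [Arr.mulInv, Arr.inv, Fiber.arr]

theorem mulInv_unit (γ : Arr X) : γ.mulInv (unitFiber γ.src) = γ := by
  simp [Arr.mulInv, unitFiber]

theorem unit_mulInv {x : X} (α : Fiber x) :
    (unitFiber x).arr.mulInv α = α.arr.inv := by
  simp [Arr.mulInv, unitFiber, Arr.inv, Fiber.arr]

theorem translOp_surjective {x y : X} (β : x ⟶ y) :
    Function.Surjective (translOp β : Ell2 y → Ell2 x) := by
  intro v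
  refine ⟨translOp (Groupoid.inv β) v, ?_⟩
  ext γ
  simp [translOp_apply, transl]

theorem inner_translOp {x y : X} (β : x ⟶ y) (v w : Ell2 y) :
    inner ℂ (translOp β v) (translOp β w) = inner ℂ v w := by
  rw [lp.inner_eq_tsum, lp.inner_eq_tsum]
  exact (transl β).tsum_eq fun γ => inner ℂ (v γ) (w γ)

theorem translOp_delta {x y : X} (β : x ⟶ y) (γ : Fiber x) :
    translOp β (delta (transl β γ)) = delta γ := by
  ext α
  rw [translOp_apply]
  by_cases h : α = γ
  · rw [h, delta_apply_self, delta_apply_self]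
  · rw [delta_apply_ne h, delta_apply_ne ((transl β).injective.ne h)]

/-- This is why the columns at units determine an operator that commutes with translations. -/
theorem translOp_delta_unit {x : X} (γ : Fiber x) :
    translOp γ.2 (delta (unitFiber γ.1)) = delta γ := by
  rw [← translOp_delta γ.2 γ, transl_self]

theorem restr_ext {ξ η : L2 X} (h : ∀ x, restr x ξ = restr x η) : ξ = η := by
  apply Subtype.ext
  ext x : 2
  exact h x

theorem restr_rho (g : C_c(Arr X, ℂ)) (ξ : L2 X) (x : X) :
    restr x (rho g ξ) =
      ∑ β ∈ (cc_finite g x).toFinset, g β.arr • translOp β.2 (restr β.1 ξ) := rfl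

/-- Only the term at `β` survives in the finite sum. Single translations are thus realised by right
convolutions, which turns equivariance into a statement about fibres. -/
theorem restr_rho_delta {x : X} {β : Fiber x} {g : C_c(Arr X, ℂ)}
    (hg : restr x (L2.ofCc g) = delta β) (ξ : L2 X) :
    restr x (rho g ξ) = translOp β.2 (restr β.1 ξ) := by
  have h : ∀ α : Fiber x, g α.arr = delta β α := fun α => by rw [← hg]; rfl
  rw [restr_rho, Finset.sum_eq_single β]
  · rw [h, delta_apply_self, one_smul]
  · intro α _ hα
    rw [h, delta_apply_ne hα, zero_smul]
  · intro hβ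
    simp [h, delta_apply_self] at hβ

theorem inner_eq_tsum_conj {x : X} (v w : Ell2 x) :
    inner ℂ v w = ∑' α : Fiber x, conj (v α) * w α := by
  rw [lp.inner_eq_tsum]
  refine tsum_congr fun α => ?_
  rw [RCLike.inner_apply, mul_comm]

/-! ### Continuity and boundedness -/

theorem L2.norm_toFun_le (ξ : L2 X) (γ : Arr X) : ‖ξ.toFun γ‖ ≤ ‖ξ‖ :=
  (lp.norm_apply_le_norm (by simp) (ξ.1 γ.src) γ.toFiber).trans
    (lp.norm_apply_le_norm (by simp) ξ.1 γ.src)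

/-- The module norm dominates the supremum norm, so approximants from `C_c(𝒢)` converge uniformly.
-/
theorem L2.continuous_toFun (ξ : L2 X) : Continuous ξ.toFun := by
  have hξ : ξ.1 ∈ closure ((EtaleGroupoid.ofCc (X := X)).range : Set (Fam X)) := ξ.2
  refine continuous_of_uniform_approx_of_continuous fun U hU => ?_
  obtain ⟨ε, hε, hU⟩ := Metric.mem_uniformity_dist.1 hU
  obtain ⟨_, ⟨η, rfl⟩, hη⟩ := Metric.mem_closure_iff.1 hξ ε hε
  refine ⟨η, η.continuous, fun γ => hU ?_⟩
  rw [dist_eq_norm] at hη ⊢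
  exact (L2.norm_toFun_le (ξ - L2.ofCc η) γ).trans_lt hη

/-- An adjointable map is not assumed linear or bounded. Linearity and closedness of the graph are
both inherited from the slices, and the closed graph theorem on the complete space `L²(𝒢)` does the
rest. -/
theorem exists_norm_le (T : Adjointable X) : ∃ C : ℝ, 0 ≤ C ∧ ∀ ξ, ‖T.1 ξ‖ ≤ C * ‖ξ‖ := by
  let L : L2 X →ₗ[ℂ] L2 X :=
    { toFun := T.1
      map_add' := fun ξ η => restr_ext fun x => by
        rw [map_add, ← slice_apply, ← slice_apply, ← slice_apply, map_add, map_add]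
      map_smul' := fun c ξ => restr_ext fun x => by
        rw [RingHom.id_apply, map_smul, ← slice_apply, ← slice_apply, map_smul, map_smul] }
  have hL : Continuous L := L.continuous_of_seq_closed_graph fun u ξ η hu hη =>
    restr_ext fun x => by
    have h1 : Tendsto (fun n => restr x (L (u n))) atTop (𝓝 (restr x η)) :=
      ((restr x).continuous.tendsto _).comp hη
    have h2 : Tendsto (fun n => slice T x (restr x (u n))) atTop (𝓝 (slice T x (restr x ξ))) :=
      ((slice T x).continuous.tendsto _).comp (((restr x).continuous.tendsto _).comp hu)
    simp only [slice_apply] at h2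
    exact tendsto_nhds_unique h1 h2
  let L' : L2 X →L[ℂ] L2 X := ⟨L, hL⟩
  exact ⟨‖L'‖, L'.opNorm_nonneg, L'.le_opNorm⟩

theorem exists_norm_slice_le (T : Adjointable X) :
    ∃ C : ℝ, ∀ (x : X) (v : Ell2 x), ‖slice T x v‖ ≤ C * ‖v‖ := by
  obtain ⟨C, hC0, hC⟩ := exists_norm_le T
  -- The factor 2 is the cost of lifting a vector of `ℓ²(𝒢ₓ)` to `L²(𝒢)` with control of the norm;
  -- it does not depend on `x`.
  refine ⟨C * 2, fun x v => ?_⟩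
  obtain ⟨ξ, rfl⟩ := restr_surjective x v
  obtain ⟨η, h1, h2⟩ := exists_restr_norm_le x ξ
  rw [← h1, slice_apply]
  calc ‖restr x (T.1 η)‖ ≤ ‖T.1 η‖ := lp.norm_apply_le_norm (by simp) (T.1 η).1 x
    _ ≤ C * ‖η‖ := hC η
    _ ≤ C * (2 * ‖restr x ξ‖) := by gcongr
    _ = _ := by rw [h1, mul_assoc]

/-- Near each unit, the point masses at units are restrictions of one function in `C_c(𝒢)`. -/
theorem exists_cc_delta_unit (x₀ : X) :
    ∃ η : C_c(Arr X, ℂ), ∀ᶠ x in 𝓝 x₀,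
      restr x (L2.ofCc η) = delta (unitFiber x) := by
  have hu : Continuous (Arr.unit : X → Arr X) := isInducing_unit.continuous
  obtain ⟨e, he, heq⟩ := isLocalHomeomorph_src (X := X) (Arr.unit x₀)
  -- The bump function is 1 on the compact neighbourhood `K` of the unit and vanishes off
  -- `e.source`, where the source map is injective. A fibre whose unit lies in `K` meets `e.source`
  -- only in that unit.
  obtain ⟨K, hK, hKe⟩ := exists_compact_subset e.open_source he
  obtain ⟨f, hf1, hf0, hfc, -⟩ := exists_continuous_one_zero_of_isCompact
    hK e.open_source.isClosed_compl (Set.disjoint_compl_right_iff_subset.2 hKe.2)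
  let η : C_c(Arr X, ℂ) := ⟨⟨fun γ => (f γ : ℂ), Complex.continuous_ofReal.comp f.continuous⟩,
    hfc.comp_left (g := Complex.ofReal) Complex.ofReal_zero⟩
  refine ⟨η, ?_⟩
  filter_upwards [hu.continuousAt.eventually (isOpen_interior.mem_nhds hKe.1)] with x hx
  have hxK : Arr.unit x ∈ K := interior_subset hx
  ext β
  change ((f β.arr : ℝ) : ℂ) = _
  by_cases h : β = unitFiber x
  · subst h
    rw [delta_apply_self]
    exact congrArg _ (hf1 hxK)
  · rw [delta_apply_ne h, hf0, Pi.zero_apply, Complex.ofReal_zero]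
    intro hβ
    apply h
    apply Fiber.arr_injective
    apply e.injOn hβ (hKe.2 hxK)
    rw [← heq]; rfl

/-! ### The convolution kernel of an adjointable operator -/

/-- The function `γ ↦ (Φ_{s(γ)}(T) δ_{s(γ)})(γ)`. -/
noncomputable def symbol (T : Adjointable X) (γ : Arr X) : ℂ :=
  slice T γ.src (delta (unitFiber γ.src)) γ.toFiber

theorem symbol_arr (T : Adjointable X) {x : X} (α : Fiber x) :
    symbol T α.arr = slice T x (delta (unitFiber x)) α := rfl

/-- On the arrows with source near `s(γ₀)`, the symbol coincides with the continuous function `T η`,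
where `η` restricts to the unit point masses there. -/
theorem continuous_symbol (T : Adjointable X) : Continuous (symbol T) := by
  have hs : Continuous (Arr.src : Arr X → X) := continuous_src
  rw [continuous_iff_continuousAt]
  intro γ₀
  obtain ⟨η, hη⟩ := exists_cc_delta_unit γ₀.src
  refine (L2.continuous_toFun (T.1 (L2.ofCc η))).continuousAt.congr ?_
  filter_upwards [hs.continuousAt.eventually hη] with γ hγ
  have h := slice_apply T γ.src (L2.ofCc η)
  rw [hγ] at h
  exact (congrArg (fun v : Ell2 γ.src => v γ.toFiber) h).symm

theorem norm_delta {x : X} (α : Fiber x) : ‖delta α‖ = 1 := by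
  classical
  rw [delta, lp.norm_single (by norm_num)]
  simp

theorem exists_norm_symbol_le (T : Adjointable X) : ∃ C : ℝ, ∀ γ, ‖symbol T γ‖ ≤ C := by
  obtain ⟨C, hC⟩ := exists_norm_slice_le T
  refine ⟨C, fun γ => (lp.norm_apply_le_norm (by simp) _ _).trans ((hC _ _).trans ?_)⟩
  rw [norm_delta, mul_one]

theorem memℓp_symbol (T : Adjointable X) (x : X) :
    Memℓp (fun α : Fiber x => symbol T α.arr) 2 :=
  lp.memℓp (slice T x (delta (unitFiber x)))

theorem bddAbove_symbol (T : Adjointable X) :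
    BddAbove (Set.range fun x : X => ‖(⟨_, memℓp_symbol T x⟩ : Ell2 x)‖) := by
  obtain ⟨C, hC⟩ := exists_norm_slice_le T
  refine ⟨C, ?_⟩
  rintro _ ⟨x, rfl⟩
  refine (hC x (delta (unitFiber x))).trans ?_
  rw [norm_delta, mul_one]

/-! ### Adjoints and translation invariance of slices -/

/-- `S` is the adjoint of `T`. -/
def IsAdjointPair (S T : L2 X → L2 X) : Prop :=
  ∀ η ξ : L2 X, inner C₀(X, ℂ) η (T ξ) = inner C₀(X, ℂ) (S η) ξ

theorem isAdjointPair_iff {S T : L2 X → L2 X} : IsAdjointPair S T ↔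
    ∀ x η ξ, inner ℂ (restr x η) (restr x (T ξ)) = inner ℂ (restr x (S η)) (restr x ξ) :=
  ⟨fun h x η ξ => by rw [← inner_restr, h, inner_restr],
    fun h η ξ => DFunLike.ext _ _ fun x => h x η ξ⟩

theorem IsAdjointPair.symm {S T : L2 X → L2 X} (h : IsAdjointPair S T) : IsAdjointPair T S := by
  rw [isAdjointPair_iff] at h ⊢
  intro x η ξ
  rw [← inner_conj_symm, ← h, inner_conj_symm]

theorem IsAdjointPair.inner_slice {S T : Adjointable X} (h : IsAdjointPair S.1 T.1) {x : X}
    (v w : Ell2 x) : inner ℂ v (slice T x w) = inner ℂ (slice S x v) w := by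
  obtain ⟨η, rfl⟩ := restr_surjective x v
  obtain ⟨ξ, rfl⟩ := restr_surjective x w
  rw [slice_apply, slice_apply, isAdjointPair_iff.1 h]

/-- The slices of `T` commute with the right translations of the fibres. -/
def CommutesWithTransl (T : Adjointable X) : Prop :=
  ∀ (x y : X) (β : x ⟶ y) (v : Ell2 y), slice T x (translOp β v) = translOp β (slice T y v)

/-- Apply equivariance to a `g` that restricts to `δ_β` on `𝒢ₓ`: both `ξ * g` and `(T ξ) * g`
restrict there to translates by `β`. -/
theorem IsEquivariant.commutesWithTransl {T : Adjointable X} (hT : IsEquivariant T.1) :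
    CommutesWithTransl T := by
  intro x y β v
  obtain ⟨ξ, rfl⟩ := restr_surjective y v
  obtain ⟨g, hg⟩ := exists_cc_delta (⟨y, β⟩ : Fiber x)
  have h1 := restr_rho_delta hg ξ
  have h2 := restr_rho_delta hg (T.1 ξ)
  dsimp only at h1 h2
  rw [← h1, slice_apply, slice_apply, hT, h2]

/-- Translations are unitary, so it suffices to test against translated vectors and move the
operator to the side of `T`. -/
theorem CommutesWithTransl.adjoint {S T : Adjointable X} (h : IsAdjointPair S.1 T.1)
    (hT : CommutesWithTransl T) : CommutesWithTransl S := by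
  intro x y β v
  refine ext_inner_right ℂ fun w => ?_
  obtain ⟨w, rfl⟩ := translOp_surjective β w
  rw [← h.inner_slice, hT, inner_translOp, inner_translOp, h.inner_slice]

theorem CommutesWithTransl.slice_delta {T : Adjointable X} (hT : CommutesWithTransl T) {x : X}
    (γ α : Fiber x) : slice T x (delta γ) α = symbol T (α.arr.mulInv γ) := by
  rw [← translOp_delta_unit, hT, translOp_apply, ← arr_transl, symbol_arr]

/-- The column of the adjoint at a unit is the conjugated row of `T` at that unit, whose entry at
`α` is the conjugate of `symbol T` at `α⁻¹`. -/
theorem symbol_adjoint {S T : Adjointable X} (h : IsAdjointPair S.1 T.1)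
    (hT : CommutesWithTransl T) : symbol S = adj (symbol T) := by
  have key : ∀ (x : X) (α : Fiber x), symbol S α.arr = adj (symbol T) α.arr := fun x α => by
    rw [symbol_arr, ← inner_delta_left, h.symm.inner_slice, inner_delta_right, hT.slice_delta,
      unit_mulInv, adj]
  exact funext fun γ => key γ.src γ.toFiber

/-- The value at `γ` is `⟨δ_γ, T ξ⟩ = ⟨S δ_γ, ξ⟩`, and the entries of `S δ_γ` are known from the
symbol of `S`. Moving the operator onto the point mass avoids any question of convergence. -/
theorem toFun_eq_conv_symbol {S T : Adjointable X} (h : IsAdjointPair S.1 T.1)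
    (hT : CommutesWithTransl T) (ξ : L2 X) : (T.1 ξ).toFun = conv (symbol T) ξ.toFun := by
  funext γ
  change restr γ.src (T.1 ξ) γ.toFiber = _
  rw [← slice_apply, ← inner_delta_left, h.inner_slice, inner_eq_tsum_conj, conv]
  refine tsum_congr fun α => ?_
  rw [(hT.adjoint h).slice_delta, symbol_adjoint h hT, adj, inv_mulInv, Complex.conj_conj]
  rfl

theorem isLeftConvolver_symbol {S T : Adjointable X} (h : IsAdjointPair S.1 T.1)
    (hT : CommutesWithTransl T) (f : Arr X →ᵇ ℂ) (hf : ⇑f = symbol T) : IsLeftConvolver f := by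
  have hf' : adj f = symbol S := by rw [hf, symbol_adjoint h hT]
  have h1 : ∀ x : X, Memℓp (fun α : Fiber x => f α.arr) 2 := hf ▸ memℓp_symbol T
  have h2 : ∀ x : X, Memℓp (fun α : Fiber x => adj f α.arr) 2 := hf' ▸ memℓp_symbol S
  refine ⟨h1, h2, ?_, ?_, fun g => ⟨T.1 g, ?_⟩, fun g => ⟨S.1 g, ?_⟩⟩
  · have := bddAbove_symbol T
    simp only [← hf] at this
    exact this
  · have := bddAbove_symbol S
    simp only [← hf'] at this
    exact this
  · rw [hf, toFun_eq_conv_symbol h hT]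
  · rw [hf', toFun_eq_conv_symbol h.symm (hT.adjoint h)]

/-- Convolving with a `g` that restricts to the point mass at the unit `s(γ)` leaves the single term
`f(γ)`. This gives uniqueness. -/
theorem eq_symbol_of_eq_leftConv {T : Adjointable X} {f : Arr X →ᵇ ℂ} {hf : IsLeftConvolver f}
    (hT : T.1 = leftConv f hf) : ⇑f = symbol T := by
  funext γ
  obtain ⟨g, hg⟩ := restr_surjective γ.src (delta (unitFiber γ.src))
  rw [symbol, ← hg, slice_apply, restr_apply, hT, leftConv_toFun]
  change _ = ∑' α : Fiber γ.src, f (γ.mulInv α) * restr γ.src g α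
  rw [hg]
  refine (?_ : _ = _).trans (tsum_eq_single (unitFiber γ.src) ?_).symm
  · rw [delta_apply_self, mul_one, mulInv_unit]
  · intro α hα
    rw [delta_apply_ne hα, mul_zero]

/-! ### Convolution by a left convolver -/

namespace IsLeftConvolver

variable {f : Arr X →ᵇ ℂ}

/-- The vector with `⟨row γ, v⟩ = ∑_α f(γ α⁻¹) v(α)`. -/
noncomputable def row (hf : IsLeftConvolver f) {x : X} (γ : Fiber x) : Ell2 x :=
  translOp γ.2 ⟨_, hf.memℓp_adj γ.1⟩

/-- The entry of the row at `α` is `f^*(α γ⁻¹)`, and its conjugate is `f(γ α⁻¹)` because `(α γ⁻¹)⁻¹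
= γ α⁻¹`. -/
theorem inner_row (hf : IsLeftConvolver f) {x : X} (γ : Fiber x) (v : Ell2 x) :
    inner ℂ (hf.row γ) v = ∑' α : Fiber x, f (γ.arr.mulInv α) * v α := by
  rw [inner_eq_tsum_conj]
  refine tsum_congr fun α => ?_
  congr 1
  change conj (conj (f (α.arr.mulInv γ).inv)) = _
  rw [inv_mulInv, Complex.conj_conj]

theorem restr_leftConv_apply (hf : IsLeftConvolver f) (x : X) (g : L2 X) (γ : Fiber x) :
    restr x (leftConv f hf g) γ = inner ℂ (hf.row γ) (restr x g) := by
  rw [restr_apply, leftConv_toFun, inner_row]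
  rfl

/-- Convolution by `f` on `ℓ²(𝒢ₓ)`. -/
noncomputable def fiberOp (hf : IsLeftConvolver f) (x : X) : Ell2 x →L[ℂ] Ell2 x :=
  -- The coordinates do not depend on the chosen lift of `v`, which is what makes the map linear.
  have h : ∀ (v : Ell2 x) (γ : Fiber x),
      restr x (leftConv f hf (Function.surjInv (restr_surjective x) v)) γ =
        inner ℂ (hf.row γ) v := fun v γ => by
    rw [restr_leftConv_apply, Function.surjInv_eq (restr_surjective x)]
  let A : Ell2 x →ₗ[ℂ] Ell2 x :=
    { toFun := fun v => restr x (leftConv f hf (Function.surjInv (restr_surjective x) v))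
      map_add' := fun v w => by
        ext γ
        rw [lp.coeFn_add, Pi.add_apply, h, h, h, inner_add_right]
      map_smul' := fun c v => by
        ext γ
        rw [lp.coeFn_smul, Pi.smul_apply, h, h, inner_smul_right]
        rfl }
  -- Each coordinate of `A` is pairing with a fixed `ℓ²` vector, hence continuous, so the graph is
  -- closed.
  ⟨A, A.continuous_of_seq_closed_graph fun u v w hu hw => by
    ext γ
    have h1 : Tendsto (fun n => inner ℂ (delta γ) ((A ∘ u) n)) atTop
        (𝓝 (inner ℂ (delta γ) w)) := tendsto_const_nhds.inner hw
    have h2 : Tendsto (fun n => inner ℂ (hf.row γ) (u n)) atTop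
        (𝓝 (inner ℂ (hf.row γ) v)) := tendsto_const_nhds.inner hu
    have h3 : (fun n => inner ℂ (delta γ) ((A ∘ u) n)) = fun n => inner ℂ (hf.row γ) (u n) :=
      funext fun n => (inner_delta_left _ _).trans (h _ _)
    rw [h3, inner_delta_left] at h1
    exact (tendsto_nhds_unique h1 h2).trans (h v γ).symm⟩

theorem fiberOp_apply (hf : IsLeftConvolver f) {x : X} (v : Ell2 x) (γ : Fiber x) :
    hf.fiberOp x v γ = inner ℂ (hf.row γ) v := by
  obtain ⟨g, rfl⟩ := restr_surjective x v
  refine (hf.restr_leftConv_apply x _ γ).trans ?_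
  rw [Function.surjInv_eq (restr_surjective x)]

theorem fiberOp_restr (hf : IsLeftConvolver f) (x : X) (g : L2 X) :
    hf.fiberOp x (restr x g) = restr x (leftConv f hf g) := by
  ext γ
  rw [fiberOp_apply, restr_leftConv_apply]

theorem fiberOp_delta (hf : IsLeftConvolver f) {x : X} (α γ : Fiber x) :
    hf.fiberOp x (delta α) γ = f (γ.arr.mulInv α) := by
  rw [fiberOp_apply, inner_row, tsum_eq_single α, delta_apply_self, mul_one]
  intro β hβ
  rw [delta_apply_ne hβ, mul_zero]

/-- The kernel is translation invariant, `(γ β⁻¹)(α β⁻¹)⁻¹ = γ α⁻¹`, so reindexing the sum by `α ↦ α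
β⁻¹` suffices. -/
theorem fiberOp_translOp (hf : IsLeftConvolver f) {x y : X} (β : x ⟶ y) (v : Ell2 y) :
    hf.fiberOp x (translOp β v) = translOp β (hf.fiberOp y v) := by
  ext γ
  rw [translOp_apply, fiberOp_apply, fiberOp_apply, inner_row, inner_row,
    ← (transl β).tsum_eq fun α => f ((transl β γ).arr.mulInv α) * v α]
  refine tsum_congr fun α => ?_
  rw [translOp_apply]
  congr 2
  simp [Arr.mulInv, transl, Fiber.arr]

theorem isAdjointable_leftConv (hf : IsLeftConvolver f) : IsAdjointable (leftConv f hf) := by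
  choose S hS using hf.adj_conv_mem
  refine ⟨S, isAdjointPair_iff.2 fun x η ξ => ?_⟩
  -- The Hilbert space adjoint at `α` is `⟨fiberOp δ_α, η⟩ = ∑ conj f(γ α⁻¹) η(γ)`, which is `(f^* *
  -- η)(α)`.
  have h : restr x (S η) = (hf.fiberOp x).adjoint (restr x η) := by
    ext α
    rw [restr_apply, hS, ← inner_delta_left α ((hf.fiberOp x).adjoint _),
      ContinuousLinearMap.adjoint_inner_right, inner_eq_tsum_conj]
    refine tsum_congr fun γ => congrArg (· * η.toFun γ.arr) ?_
    exact congrArg conj ((congrArg f (inv_mulInv α γ)).trans (hf.fiberOp_delta α γ).symm)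
  rw [h, ContinuousLinearMap.adjoint_inner_left, fiberOp_restr]

/-- On each fibre, right convolution by `g ∈ C_c(𝒢)` is a finite combination of translations, with
which `fiberOp` commutes. -/
theorem isEquivariant_leftConv (hf : IsLeftConvolver f) : IsEquivariant (leftConv f hf) := by
  intro g ξ
  refine restr_ext fun x => ?_
  rw [← fiberOp_restr, restr_rho, restr_rho, map_sum]
  refine Finset.sum_congr rfl fun β _ => ?_
  rw [map_smul, fiberOp_translOp, fiberOp_restr]

end IsLeftConvolver

end Topology

end EtaleGroupoid

/-! ### Left convolvers and equivariant operators -/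

theorem proposition3p18 {X : Type*} [Groupoid X] [TopologicalSpace (EtaleGroupoid.Arr X)]
    [TopologicalSpace X] [EtaleGroupoid.IsLocallyCompactEtaleGroupoid X] :
    -- convolution by a left convolver is an equivariant adjointable operator
    (∀ (f : EtaleGroupoid.Arr X →ᵇ ℂ) (hf : EtaleGroupoid.IsLeftConvolver f),
      EtaleGroupoid.IsAdjointable (EtaleGroupoid.leftConv f hf) ∧
      EtaleGroupoid.IsEquivariant (EtaleGroupoid.leftConv f hf)) ∧
    -- every equivariant adjointable operator is convolution by a unique left convolver
    (∀ T : EtaleGroupoid.Adjointable X, EtaleGroupoid.IsEquivariant T.1 →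
      ∃ (f : EtaleGroupoid.Arr X →ᵇ ℂ) (hf : EtaleGroupoid.IsLeftConvolver f),
        T.1 = EtaleGroupoid.leftConv f hf ∧
        (∀ γ : EtaleGroupoid.Arr X, f γ =
          EtaleGroupoid.slice T γ.src
            (EtaleGroupoid.delta (EtaleGroupoid.Arr.unit γ.src).toFiber) γ.toFiber) ∧
        ∀ (f' : EtaleGroupoid.Arr X →ᵇ ℂ) (hf' : EtaleGroupoid.IsLeftConvolver f'),
          T.1 = EtaleGroupoid.leftConv f' hf' → f' = f) := by
  refine ⟨fun f hf => ⟨hf.isAdjointable_leftConv, hf.isEquivariant_leftConv⟩, fun T hT => ?_⟩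
  have hc := hT.commutesWithTransl
  obtain ⟨S, hS⟩ := T.2
  have hS' : EtaleGroupoid.IsAdjointPair S T.1 := hS
  -- The adjoint is itself adjointable, with adjoint `T`, so it has slices and a symbol of its own;
  -- these supply the conditions on `f^*`.
  let S' : EtaleGroupoid.Adjointable X := ⟨S, T.1, hS'.symm⟩
  have hST : EtaleGroupoid.IsAdjointPair S'.1 T.1 := hS
  obtain ⟨C, hC⟩ := EtaleGroupoid.exists_norm_symbol_le T
  let f : EtaleGroupoid.Arr X →ᵇ ℂ :=
    BoundedContinuousFunction.ofNormedAddCommGroup _ (EtaleGroupoid.continuous_symbol T) C hC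
  have hf : EtaleGroupoid.IsLeftConvolver f :=
    EtaleGroupoid.isLeftConvolver_symbol hST hc f rfl
  refine ⟨f, hf, funext fun ξ => EtaleGroupoid.L2.toFun_injective ?_, fun γ => rfl,
    fun f' hf' h => DFunLike.coe_injective (EtaleGroupoid.eq_symbol_of_eq_leftConv h)⟩
  rw [EtaleGroupoid.leftConv_toFun, EtaleGroupoid.toFun_eq_conv_symbol hST hc]
  rfl
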